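/- **Definitions.** Let $\Sigma$ be a finite alphabet and $\Gamma=\Sigma\cup\{\#,\$\}$, where $\#,\$\notin\Sigma$ are end-markers. A *1-way probabilistic reversible C-automaton* (PRA-C) $A=(Q,\Sigma,q_0,Q_F,\delta)$ consists of a finite set of states $Q$, an initial state $q_0\in Q$, a set of accepting states $Q_F\subseteq Q$ and a transition function $\delta:Q\times\Gamma\times Q\to[0,1]$ such that for all $q\in Q$ and $\sigma\in\Gamma$ $$\sum_{q'\in Q}\delta(q,\sigma,q')=1\quad\text{and}\quad\sum_{q'\in Q}\delta(q',\sigma,q)=1.$$ Here $\delta(q,\sigma,q')$ is the probability to go from state $q$ to state $q'$ when $\sigma$ is read. Let $P_{w,A}$ be the probability that $A$, started in $q_0$, is in a state of $Q_F$ after having read $\#w\$$. The automaton $A$ *recognizes* a language $L\subseteq\Sigma^*$ (with bounded error) if $p_1<p_2$, where $p_1=\sup\{P_{w,A}: w\notin L\}$ and $p_2=\inf\{P_{w,A}: w\in L\}$ (supremum and infimum in $[0,1]$, so that $\sup\emptyset=0$ and $\inf\emptyset=1$). A language is *recognized by PRA-C* if some PRA-C recognizes it. Write $(a,b)^*$ for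 the set of all words in the letters $a,b$. **Statement.** 1. Over every finite alphabet $\Sigma$ that contains two distinct letters $a,b$, neither the language $(a,b)^*a$ nor the language $a(a,b)^*$ is recognized by PRA-C. 2. The language $(a,b)^*cc^*$ over the alphabet $\{a,b,c\}$ (three distinct letters) is recognized by PRA-C, and its image under the homomorphism $\{a,b,c\}^*\to\{a,b\}^*$ with $a\mapsto a$, $b\mapsto b$, $c\mapsto a$ is $(a,b)^*a$. 3. Consequently, the class of languages recognized by PRA-C is not closed under homomorphisms: it is not true that for all finite alphabets $\Sigma,T$, every homomorphism $h:\Sigma^*\to T^*$ and every $L\subseteq\Sigma^*$ recognized by PRA-C, the image $h(L)\subseteq T^*$ is recognized by PRA-C. -/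

import Mathlib

namespace PRA

/-- The input tape alphabet `Γ = Σ ∪ {#, $}`: the letters of `Σ` and two end-markers that do not
belong to `Σ`. -/
inductive TapeSymbol (α : Type*) where
  | leftEnd : TapeSymbol α
  | letter (x : α) : TapeSymbol α
  | rightEnd : TapeSymbol α

/-- A 1-way probabilistic reversible C-automaton (PRA-C) with finite set of states `Q` over the
input alphabet `α`. `δ q σ q'` is the probability to go from `q` to `q'` when `σ` is read. -/
structure PRAC (Q : Type*) [Fintype Q] (α : Type*) where
  init : Q
  accepting : Finset Q
  δ : Q → TapeSymbol α → Q → ℝ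
  δ_nonneg : ∀ q σ q', 0 ≤ δ q σ q'
  δ_le_one : ∀ q σ q', δ q σ q' ≤ 1
  sum_target : ∀ q σ, ∑ q', δ q σ q' = 1
  sum_source : ∀ q' σ, ∑ q, δ q σ q' = 1

namespace PRAC

variable {Q : Type*} [Fintype Q] {α : Type*}

open Classical in
/-- The probability distribution on states before anything is read. -/
noncomputable def initDist (A : PRAC Q α) : Q → ℝ := fun q => if q = A.init then 1 else 0

/-- The probability distribution on states after the symbol `σ` is read, starting from `p`. -/
noncomputable def step (A : PRAC Q α) (p : Q → ℝ) (σ : TapeSymbol α) : Q → ℝ :=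
  fun q' => ∑ q, p q * A.δ q σ q'

/-- The tape content `#w$`. -/
def tape (w : List α) : List (TapeSymbol α) :=
  TapeSymbol.leftEnd :: (w.map TapeSymbol.letter ++ [TapeSymbol.rightEnd])

/-- The probability distribution on states after the whole of `#w$` is read. -/
noncomputable def finalDist (A : PRAC Q α) (w : List α) : Q → ℝ :=
  (tape w).foldl A.step A.initDist

/-- The probability that the word `w` is accepted (classical acceptance): that the automaton is in
an accepting state after the last symbol of `#w$` is read. -/
noncomputable def acceptProb (A : PRAC Q α) (w : List α) : ℝ :=
  ∑ q ∈ A.accepting, A.finalDist w q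

/-- `A` recognizes `L` with bounded error with interval `(p₁, p₂)`: `p₁ < p₂`, `p₁` is the supremum
of the acceptance probabilities of the words outside `L`, and `p₂` is the infimum of the acceptance
probabilities of the words in `L`. Probabilities are elements of `[0, 1]`, and supremum and infimum
are those of the ordered set `[0, 1]`: inserting `0` and `1` only has an effect if there is no word
outside `L`, or no word in `L` (`sup ∅ = 0` and `inf ∅ = 1`). -/
def RecognizesWithInterval (A : PRAC Q α) (L : Language α) (p₁ p₂ : ℝ) : Prop :=
  p₁ < p₂ ∧
  IsLUB (insert 0 {r : ℝ | ∃ w, w ∉ L ∧ r = A.acceptProb w}) p₁ ∧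
  IsGLB (insert 1 {r : ℝ | ∃ w, w ∈ L ∧ r = A.acceptProb w}) p₂

theorem foldl_step_dist (A : PRAC Q α) (l : List (TapeSymbol α)) (p : Q → ℝ)
    (h0 : ∀ q, 0 ≤ p q) (h1 : ∑ q, p q = 1) :
    (∀ q, 0 ≤ l.foldl A.step p q) ∧ ∑ q, l.foldl A.step p q = 1 := by
  induction l generalizing p with
  | nil => exact ⟨h0, h1⟩
  | cons σ l ih =>
    refine ih _ (fun q => Finset.sum_nonneg fun q' _ => mul_nonneg (h0 _) (A.δ_nonneg _ _ _)) ?_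
    simp only [step]
    rw [Finset.sum_comm]
    simp_rw [← Finset.mul_sum, A.sum_target, mul_one]
    exact h1

/-- Acceptance probabilities lie in `[0, 1]`. -/
theorem acceptProb_mem_Icc (A : PRAC Q α) (w : List α) : A.acceptProb w ∈ Set.Icc (0 : ℝ) 1 := by
  obtain ⟨h0, h1⟩ := foldl_step_dist A (tape w) A.initDist
    (fun q => by unfold initDist; split_ifs <;> norm_num) 
    (by
      classical
      rw [Finset.sum_eq_single_of_mem A.init (Finset.mem_univ _)
        (fun q _ hq => by simp [initDist, hq])]
      simp [initDist])
  exact ⟨Finset.sum_nonneg fun q _ => h0 q,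
    (Finset.sum_le_univ_sum_of_nonneg fun q => h0 q).trans_eq h1⟩

end PRAC

/-- `L` is recognized (with bounded error) by some PRA-C. -/
def IsRecognizable {α : Type*} (L : Language α) : Prop :=
  ∃ (Q : Type) (_ : Fintype Q) (A : PRAC Q α) (p₁ p₂ : ℝ), A.RecognizesWithInterval L p₁ p₂

/-- The image of the language `L` under the homomorphism of free monoids `α* → β*` that is
determined by `h : α → β*`. -/
def homImage {α β : Type*} (h : α → List β) (L : Language α) : Language β :=
  {v | ∃ w ∈ L, v = w.flatMap h}

/-- The class of languages (over finite alphabets) recognized by PRA-C is closed under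
homomorphisms. -/
def ClosedUnderHomomorphisms : Prop :=
  ∀ (α β : Type) [Finite α] [Finite β] (h : α → List β) (L : Language α),
    IsRecognizable L → IsRecognizable (homImage h L)

/-- The language `x` that consists of the one-letter word `x`. -/
def single {α : Type*} (x : α) : Language α := {[x]}

/-- The language `(a,b)*` of all words in the letters `a` and `b`. -/
def abStar {α : Type*} (a b : α) : Language α := KStar.kstar (single a + single b)

end PRA

/-!
Reading a letter multiplies the distribution on states, as a row vector, by a doubly stochastic
matrix. Such a matrix is a contraction for the Euclidean norm, so an idempotent one is an orthogonal
projection, in particular symmetric (`transpose_eq_self_of_isIdempotentElem`).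

Let `S` be the set of matrices of the words in `a` and `b` that start and end with `a`, and `T` the
same set for words that start and end with `b`. Their closures are compact semigroups and contain
idempotents `E` and `F`. Some idempotent `G` is a limit of powers of `E * F`, as in von Neumann's
alternating projections. Symmetry gives `E * G = G = G * E` and `F * G = G = G * F`, and from this
`G` lies in both closures (`closure_inter_closure_nonempty`). Acceptance probability is a continuous
function of the word matrix, so no PRA-C can accept all words of the first kind and reject all words
of the second kind with bounded error (`not_isRecognizable_of_wordsFromTo`). Both `(a,b)*a` and
`a(a,b)*` would require this.

The language `(a,b)*cc*` is recognized with three states, starting in `0` and accepting in `1`: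
`a` and `b` average the states `1` and `2`, and `c` averages the states `0` and `1`. Words of
the language are accepted with probability `1/2`. A word without `c` is accepted with probability
`0`. If some `c` is followed by `a` or `b`, then the state `2` has acquired probability at least
`1/4`, the distribution is decreasing, and both facts persist, so that the state `1` has probability
at most `3/8` (`abccDist_invariant`). Since `(a,b)*a` is a homomorphic image of this language, the
class is not closed under homomorphisms.
-/

namespace PRA

open Matrix
open scoped Pointwise

/-! ### Doubly stochastic matrices -/

section Matrices

variable {n : Type*} [Fintype n]

lemma trace_transpose_mul_self_eq_sum (M : Matrix n n ℝ) :
    (Mᵀ * M).trace = ∑ j, ∑ i, M i j ^ 2 := by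
  simp [trace, mul_apply, sq]

lemma closure_mul_closure_subset (S T : Set (Matrix n n ℝ)) :
    closure S * closure T ⊆ closure (S * T) := by
  rintro _ ⟨x, hx, y, hy, rfl⟩
  exact map_mem_closure₂ continuous_mul hx hy fun a ha b hb => Set.mul_mem_mul ha hb

variable [DecidableEq n]

lemma isCompact_doublyStochastic : IsCompact (doublyStochastic ℝ n : Set (Matrix n n ℝ)) := by
  have hK : IsCompact (Set.univ.pi fun _ => Set.univ.pi fun _ => Set.Icc 0 1 :
      Set (Matrix n n ℝ)) :=
    isCompact_univ_pi fun _ => isCompact_univ_pi fun _ => isCompact_Icc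
  refine hK.of_isClosed_subset ?_ fun M hM i _ j _ =>
    ⟨nonneg_of_mem_doublyStochastic hM, le_one_of_mem_doublyStochastic hM⟩
  have h : (doublyStochastic ℝ n : Set (Matrix n n ℝ)) =
      {M | ∀ i j, 0 ≤ M i j} ∩ ({M | ∀ i, ∑ j, M i j = 1} ∩ {M | ∀ j, ∑ i, M i j = 1}) := by
    ext M
    exact mem_doublyStochastic_iff_sum
  rw [h]
  simp only [Set.ofPred_forall]
  refine .inter (isClosed_iInter fun i => isClosed_iInter fun j => ?_)
    (.inter (isClosed_iInter fun i => ?_) (isClosed_iInter fun j => ?_))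
  · exact isClosed_le continuous_const (by fun_prop)
  · exact isClosed_eq (by fun_prop) continuous_const
  · exact isClosed_eq (by fun_prop) continuous_const

/-- Multiplication by a doubly stochastic matrix does not increase the Frobenius norm: this is
Jensen's inequality for the rows of `M`, summed over the columns of `M`. -/
lemma trace_transpose_mul_self_mul_le {M : Matrix n n ℝ} (hM : M ∈ doublyStochastic ℝ n)
    (N : Matrix n n ℝ) : ((M * N)ᵀ * (M * N)).trace ≤ (Nᵀ * N).trace := by
  rw [trace_transpose_mul_self_eq_sum, trace_transpose_mul_self_eq_sum]
  refine Finset.sum_le_sum fun j _ => ?_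
  calc ∑ i, (M * N) i j ^ 2 ≤ ∑ i, ∑ k, M i k * N k j ^ 2 := by
        refine Finset.sum_le_sum fun i _ => ?_
        have := (even_two.convexOn_pow (𝕜 := ℝ)).map_sum_le (t := Finset.univ) (w := M i)
          (p := fun k => N k j) (fun k _ => nonneg_of_mem_doublyStochastic hM)
          (sum_row_of_mem_doublyStochastic hM i) fun _ _ => Set.mem_univ _
        simpa [mul_apply] using this
    _ = ∑ k, N k j ^ 2 := by
        rw [Finset.sum_comm]
        simp_rw [← Finset.sum_mul, sum_col_of_mem_doublyStochastic hM, one_mul]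

/-- An idempotent doubly stochastic matrix is an idempotent contraction of a Euclidean space, hence
an orthogonal projection. The proof shows that the Frobenius norm of `P - Pᵀ * P` vanishes. -/
lemma transpose_eq_self_of_isIdempotentElem {P : Matrix n n ℝ} (hP : P ∈ doublyStochastic ℝ n)
    (hPP : P * P = P) : Pᵀ = P := by
  have hT : Pᵀ * Pᵀ = Pᵀ := by rw [← transpose_mul, hPP]
  have hD : (P - Pᵀ * P)ᵀ * (P - Pᵀ * P) = (Pᵀ * P)ᵀ * (Pᵀ * P) - Pᵀ * P := by
    have h1 : Pᵀ * (Pᵀ * P) = Pᵀ * P := by rw [← mul_assoc, hT]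
    simp only [transpose_sub, transpose_mul, transpose_transpose, sub_mul, mul_sub, mul_assoc, hPP,
      h1]
    abel
  have hle := trace_transpose_mul_self_mul_le (transpose_mem_doublyStochastic_iff.2 hP) P
  have hz : ((P - Pᵀ * P)ᵀ * (P - Pᵀ * P)).trace = 0 := by
    refine le_antisymm ?_ ?_
    · rw [hD, trace_sub]
      linarith
    · rw [trace_transpose_mul_self_eq_sum]
      positivity
  have h0 : P - Pᵀ * P = 0 := by
    rw [← conjTranspose_eq_transpose_of_trivial (P - Pᵀ * P)] at hz
    exact trace_conjTranspose_mul_self_eq_zero_iff.1 hz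
  rw [sub_eq_zero.1 h0, transpose_mul, transpose_transpose]

lemma closure_subset_doublyStochastic {S : Set (Matrix n n ℝ)}
    (hS : S ⊆ doublyStochastic ℝ n) : closure S ⊆ doublyStochastic ℝ n :=
  closure_minimal hS isCompact_doublyStochastic.isClosed

lemma exists_idempotent_mem_closure {S : Set (Matrix n n ℝ)} (hS : S ⊆ doublyStochastic ℝ n)
    (hne : S.Nonempty) (hSS : S * S ⊆ S) : ∃ P ∈ closure S, P * P = P :=
  exists_idempotent_in_compact_subsemigroup (fun _ => by fun_prop) _ hne.closure
    (isCompact_doublyStochastic.of_isClosed_subset isClosed_closure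
      (closure_subset_doublyStochastic hS))
    fun _ hx _ hy => closure_mono hSS (closure_mul_closure_subset S S (Set.mul_mem_mul hx hy))

/-- Let `S` and `T` be semigroups of doubly stochastic matrices that absorb each other from both
sides. Then their closures meet. With idempotents `E` and `F` in the closures of `S` and `T`, a
common point is an idempotent limit `G` of powers of `E * F`: it is unchanged by `E` on the left and
by `F` on the right and, since `E`, `F` and `G` are symmetric, by both on both sides. -/
theorem closure_inter_closure_nonempty {S T : Set (Matrix n n ℝ)}
    (hS : S ⊆ doublyStochastic ℝ n) (hT : T ⊆ doublyStochastic ℝ n)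
    (hS0 : S.Nonempty) (hT0 : T.Nonempty) (hSS : S * S ⊆ S) (hTT : T * T ⊆ T)
    (hSTS : S * T * S ⊆ S) (hTST : T * S * T ⊆ T) : (closure S ∩ closure T).Nonempty := by
  obtain ⟨E, hE, hEE⟩ := exists_idempotent_mem_closure hS hS0 hSS
  obtain ⟨F, hF, hFF⟩ := exists_idempotent_mem_closure hT hT0 hTT
  have hEd := closure_subset_doublyStochastic hS hE
  have hFd := closure_subset_doublyStochastic hT hF
  have hmul {A B C : Set (Matrix n n ℝ)} (h : A * B * C ⊆ C) {x y z : Matrix n n ℝ}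
      (hx : x ∈ closure A) (hy : y ∈ closure B) (hz : z ∈ closure C) : x * y * z ∈ closure C :=
    closure_mono h (closure_mul_closure_subset _ _ (Set.mul_mem_mul
      (closure_mul_closure_subset _ _ (Set.mul_mem_mul hx hy)) hz))
  set R : Set (Matrix n n ℝ) := Set.range fun k : ℕ => (E * F) ^ (k + 1) with hR
  have hRd : R ⊆ doublyStochastic ℝ n := by
    rintro _ ⟨k, rfl⟩
    exact pow_mem (mul_mem hEd hFd) _
  have hRR : R * R ⊆ R := by
    rintro _ ⟨_, ⟨k, rfl⟩, _, ⟨l, rfl⟩, rfl⟩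
    exact ⟨k + l + 1, by simp only [← pow_add]; congr 1; omega⟩
  obtain ⟨G, hG, hGG⟩ := exists_idempotent_mem_closure hRd (Set.range_nonempty _) hRR
  have hGd := closure_subset_doublyStochastic hRd hG
  have hEG : E * G = G := by
    refine closure_minimal (s := R) (t := {X | E * X = X}) ?_
      (isClosed_eq (by fun_prop) continuous_id) hG
    rintro _ ⟨k, rfl⟩
    simp only [Set.mem_ofPred_eq, pow_succ', ← mul_assoc, hEE]
  have hGF : G * F = G := by
    refine closure_minimal (s := R) (t := {X | X * F = X}) ?_
      (isClosed_eq (by fun_prop) continuous_id) hG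
    rintro _ ⟨k, rfl⟩
    simp only [Set.mem_ofPred_eq, pow_succ, mul_assoc, hFF]
  have hE' := transpose_eq_self_of_isIdempotentElem hEd hEE
  have hF' := transpose_eq_self_of_isIdempotentElem hFd hFF
  have hG' := transpose_eq_self_of_isIdempotentElem hGd hGG
  have hGE : G * E = G := by
    have := congrArg transpose hEG
    rwa [transpose_mul, hE', hG'] at this
  have hFG : F * G = G := by
    have := congrArg transpose hGF
    rwa [transpose_mul, hF', hG'] at this
  refine ⟨G, ?_, ?_⟩
  · rw [← hGE]
    refine closure_minimal (s := R) (t := {X | X * E ∈ closure S}) ?_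
      (isClosed_closure.preimage (by fun_prop)) hG
    rintro _ ⟨k, rfl⟩
    simp only [Set.mem_ofPred_eq]
    induction k with
    | zero => simpa using hmul hSTS hE hF hE
    | succ k ih => rw [pow_succ', mul_assoc]; exact hmul hSTS hE hF ih
  · rw [← hFG]
    refine closure_minimal (s := R) (t := {X | F * X ∈ closure T}) ?_
      (isClosed_closure.preimage (by fun_prop)) hG
    rintro _ ⟨k, rfl⟩
    simp only [Set.mem_ofPred_eq]
    induction k with
    | zero => simpa [mul_assoc] using hmul hTST hF hE hF
    | succ k ih =>
      rw [pow_succ', ← mul_assoc, ← mul_assoc, mul_assoc F E F, mul_assoc F, mul_assoc E,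
        ← mul_assoc]
      exact hmul hTST hF hE ih

end Matrices

/-! ### Languages that no PRA-C recognizes -/

namespace PRAC

variable {Q : Type*} [Fintype Q] {α : Type*}

/-- The transition matrix of the tape symbol `σ`. It acts from the right on distributions, regarded
as row vectors. -/
def transitionMatrix (A : PRAC Q α) (σ : TapeSymbol α) : Matrix Q Q ℝ :=
  of fun q q' => A.δ q σ q'

lemma transitionMatrix_mem_doublyStochastic [DecidableEq Q] (A : PRAC Q α) (σ : TapeSymbol α) :
    A.transitionMatrix σ ∈ doublyStochastic ℝ Q :=
  mem_doublyStochastic_iff_sum.2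
    ⟨fun q q' => A.δ_nonneg q σ q', fun q => A.sum_target q σ, fun q' => A.sum_source q' σ⟩

lemma step_eq_vecMul (A : PRAC Q α) (p : Q → ℝ) (σ : TapeSymbol α) :
    A.step p σ = p ᵥ* A.transitionMatrix σ := rfl

lemma foldl_step_eq_vecMul [DecidableEq Q] (A : PRAC Q α) (l : List (TapeSymbol α)) (p : Q → ℝ) :
    l.foldl A.step p = p ᵥ* (l.map A.transitionMatrix).prod := by
  induction l generalizing p with
  | nil => simp
  | cons σ l ih =>
    rw [List.foldl_cons, ih, List.map_cons, List.prod_cons, ← vecMul_vecMul,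
      step_eq_vecMul]

/-- The product of the transition matrices of the letters of `w`, without the end-markers. -/
def wordMatrix [DecidableEq Q] (A : PRAC Q α) (w : List α) : Matrix Q Q ℝ :=
  (w.map fun x => A.transitionMatrix (.letter x)).prod

lemma wordMatrix_append [DecidableEq Q] (A : PRAC Q α) (u v : List α) :
    A.wordMatrix (u ++ v) = A.wordMatrix u * A.wordMatrix v := by
  simp [wordMatrix]

lemma wordMatrix_mem_doublyStochastic [DecidableEq Q] (A : PRAC Q α) (w : List α) :
    A.wordMatrix w ∈ doublyStochastic ℝ Q := by
  refine list_prod_mem fun M hM => ?_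
  obtain ⟨x, -, rfl⟩ := List.mem_map.1 hM
  exact A.transitionMatrix_mem_doublyStochastic _

lemma acceptProb_eq_sum_vecMul [DecidableEq Q] (A : PRAC Q α) (w : List α) :
    A.acceptProb w = ∑ q ∈ A.accepting, (A.initDist ᵥ* (A.transitionMatrix .leftEnd *
      (A.wordMatrix w * A.transitionMatrix .rightEnd))) q := by
  simp [acceptProb, finalDist, foldl_step_eq_vecMul, tape, wordMatrix, Function.comp_def,
    step_eq_vecMul, vecMul_vecMul, mul_assoc]

end PRAC

section

variable {α : Type*}

/-- The words in the letters `a` and `b` whose first letter and whose last letter are `x`. -/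
def wordsFromTo (a b x : α) : Set (List α) :=
  {w | (∀ y ∈ w, y = a ∨ y = b) ∧ (∃ u, w = x :: u) ∧ ∃ u, w = u ++ [x]}

lemma append_mem_wordsFromTo {a b x : α} {u v : List α} (hu : u ∈ wordsFromTo a b x)
    (hv : v ∈ wordsFromTo a b x) : u ++ v ∈ wordsFromTo a b x := by
  obtain ⟨hu, ⟨u', hu'⟩, -⟩ := hu
  obtain ⟨hv, -, v', hv'⟩ := hv
  refine ⟨fun y hy => (List.mem_append.1 hy).elim (hu y) (hv y), ⟨u' ++ v, by simp [hu']⟩,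
    u ++ v', by simp [hv']⟩

lemma append_append_mem_wordsFromTo {a b x z : α} {u v w : List α} (hu : u ∈ wordsFromTo a b x)
    (hv : v ∈ wordsFromTo a b z) (hw : w ∈ wordsFromTo a b x) :
    u ++ v ++ w ∈ wordsFromTo a b x := by
  obtain ⟨hu, ⟨u', hu'⟩, -⟩ := hu
  obtain ⟨hw, -, w', hw'⟩ := hw
  refine ⟨fun y hy => ?_, ⟨u' ++ v ++ w, by simp [hu']⟩, u ++ v ++ w', by simp [hw']⟩
  rw [List.append_assoc, List.mem_append, List.mem_append] at hy
  exact hy.elim (hu y) fun hy => hy.elim (hv.1 y) (hw y)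

/-- No PRA-C separates the words from `a` to `a` from the words from `b` to `b`: the closures of the
two sets of word matrices have a point in common, and the acceptance probability is a continuous
function of the word matrix. -/
theorem not_isRecognizable_of_wordsFromTo {L : Language α} {a b : α}
    (ha : ∀ w ∈ wordsFromTo a b a, w ∈ L) (hb : ∀ w ∈ wordsFromTo a b b, w ∉ L) :
    ¬ IsRecognizable L := by
  rintro ⟨Q, _, A, p₁, p₂, hlt, hlub, hglb⟩
  classical
  have hd (x : α) : A.wordMatrix '' wordsFromTo a b x ⊆ doublyStochastic ℝ Q := by
    rintro _ ⟨w, -, rfl⟩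
    exact A.wordMatrix_mem_doublyStochastic w
  have hne (x : α) (hx : x = a ∨ x = b) : (A.wordMatrix '' wordsFromTo a b x).Nonempty :=
    ⟨_, [x], ⟨by simpa using hx, ⟨[], rfl⟩, [], rfl⟩, rfl⟩
  have hmul (x : α) : A.wordMatrix '' wordsFromTo a b x * A.wordMatrix '' wordsFromTo a b x ⊆
      A.wordMatrix '' wordsFromTo a b x := by
    rintro _ ⟨_, ⟨u, hu, rfl⟩, _, ⟨v, hv, rfl⟩, rfl⟩
    exact ⟨u ++ v, append_mem_wordsFromTo hu hv, A.wordMatrix_append u v⟩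
  have hmul' (x z : α) : A.wordMatrix '' wordsFromTo a b x * A.wordMatrix '' wordsFromTo a b z *
      A.wordMatrix '' wordsFromTo a b x ⊆ A.wordMatrix '' wordsFromTo a b x := by
    rintro _ ⟨_, ⟨_, ⟨u, hu, rfl⟩, _, ⟨v, hv, rfl⟩, rfl⟩, _, ⟨w, hw, rfl⟩, rfl⟩
    exact ⟨u ++ v ++ w, append_append_mem_wordsFromTo hu hv hw, by
      simp only [A.wordMatrix_append]⟩
  obtain ⟨G, hGa, hGb⟩ := closure_inter_closure_nonempty (hd a) (hd b) (hne a (.inl rfl))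
    (hne b (.inr rfl)) (hmul a) (hmul b) (hmul' a b) (hmul' b a)
  set g : Matrix Q Q ℝ → ℝ := fun M => ∑ q ∈ A.accepting, (A.initDist ᵥ*
    (A.transitionMatrix .leftEnd * (M * A.transitionMatrix .rightEnd))) q with hg
  have hgc : Continuous g := by
    refine continuous_finsetSum _ fun q _ => ?_
    have : Continuous fun M => A.initDist ᵥ*
        (A.transitionMatrix .leftEnd * (M * A.transitionMatrix .rightEnd)) :=
      continuous_const.matrix_vecMul (by fun_prop)
    exact (continuous_apply q).comp this
  have h2 : p₂ ≤ g G := by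
    refine closure_minimal (t := {M | p₂ ≤ g M}) ?_ (isClosed_le continuous_const hgc) hGa
    rintro _ ⟨w, hw, rfl⟩
    exact hglb.1 (Or.inr ⟨w, ha w hw, (A.acceptProb_eq_sum_vecMul w).symm⟩)
  have h1 : g G ≤ p₁ := by
    refine closure_minimal (t := {M | g M ≤ p₁}) ?_ (isClosed_le hgc continuous_const) hGb
    rintro _ ⟨w, hw, rfl⟩
    exact hlub.1 (Or.inr ⟨w, hb w hw, (A.acceptProb_eq_sum_vecMul w).symm⟩)
  exact absurd hlt (h2.trans h1).not_gt

/-! ### The languages `(a,b)*`, `(a,b)*a`, `a(a,b)*` and `(a,b)*cc*` -/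

lemma mem_single {x : α} {w : List α} : w ∈ single x ↔ w = [x] := Iff.rfl

lemma mem_abStar {a b : α} {w : List α} : w ∈ abStar a b ↔ ∀ x ∈ w, x = a ∨ x = b := by
  rw [abStar, Language.mem_kstar]
  constructor
  · rintro ⟨l, hw, hl⟩ x hx
    rw [hw] at hx
    obtain ⟨y, hy, hxy⟩ := List.mem_flatten.1 hx
    rcases hl y hy with rfl | rfl
    · exact .inl (List.mem_singleton.1 hxy)
    · exact .inr (List.mem_singleton.1 hxy)
  · intro h
    refine ⟨w.map fun x => [x], ?_, fun y hy => ?_⟩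
    · rw [← List.flatMap_def, List.flatMap_singleton']
    obtain ⟨x, hx, rfl⟩ := List.mem_map.1 hy
    exact (h x hx).imp (fun h => by rw [h]; exact mem_single.2 rfl)
      fun h => by rw [h]; exact mem_single.2 rfl

lemma mem_mul_single {L : Language α} {x : α} {w : List α} :
    w ∈ L * single x ↔ ∃ u ∈ L, u ++ [x] = w := by
  simp [Language.mem_mul, mem_single]

lemma mem_single_mul {L : Language α} {x : α} {w : List α} :
    w ∈ single x * L ↔ ∃ u ∈ L, x :: u = w := by
  simp [Language.mem_mul, mem_single]

lemma not_isRecognizable_abStar_mul_single {a b : α} (hab : a ≠ b) :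
    ¬ IsRecognizable (abStar a b * single a) := by
  refine not_isRecognizable_of_wordsFromTo (a := a) (b := b) ?_ ?_
  · rintro _ ⟨h, -, u, rfl⟩
    exact mem_mul_single.2 ⟨u, mem_abStar.2 fun x hx => h x (List.mem_append_left _ hx), rfl⟩
  · rintro _ ⟨-, -, u, rfl⟩ h
    obtain ⟨v, -, hv⟩ := mem_mul_single.1 h
    exact hab (by simpa using (List.append_inj' hv rfl).2)

lemma not_isRecognizable_single_mul_abStar {a b : α} (hab : a ≠ b) :
    ¬ IsRecognizable (single a * abStar a b) := by
  refine not_isRecognizable_of_wordsFromTo (a := a) (b := b) ?_ ?_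
  · rintro _ ⟨h, ⟨u, rfl⟩, -⟩
    exact mem_single_mul.2 ⟨u, mem_abStar.2 fun x hx => h x (List.mem_cons_of_mem _ hx), rfl⟩
  · rintro _ ⟨-, ⟨u, rfl⟩, -⟩ h
    obtain ⟨v, -, hv⟩ := mem_single_mul.1 h
    exact hab (List.cons_eq_cons.1 hv).1

/-- A recursion on the last letter for membership in `(a,b)*cc*`, which is the same language as
`(a,b)*c*c` with `c* = 1 + cc*`. -/
lemma append_singleton_mem_abStar_mul {a b c x : α} {w : List α} :
    w ++ [x] ∈ abStar a b * (single c * KStar.kstar (single c)) ↔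
      x = c ∧ (w ∈ abStar a b ∨ w ∈ abStar a b * (single c * KStar.kstar (single c))) := by
  have hcomm : (single c * KStar.kstar (single c) : Language α) =
      KStar.kstar (single c) * single c := (Language.mul_self_kstar_comm _).symm
  have hunfold : (KStar.kstar (single c) : Language α) = 1 + single c * KStar.kstar (single c) :=
    Language.one_add_self_mul_kstar_eq_kstar _ |>.symm
  conv_lhs => rw [hcomm, ← mul_assoc, mem_mul_single, hunfold, mul_add, mul_one]
  constructor
  · rintro ⟨u, hu, h⟩
    obtain ⟨rfl, h⟩ := List.append_inj' h rfl
    exact ⟨(by simpa using h.symm), hu⟩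
  · rintro ⟨rfl, h⟩
    exact ⟨w, h, rfl⟩

lemma notMem_abStar_of_mem_abStar_mul {a b c : α} (ha : a ≠ c) (hb : b ≠ c) {w : List α}
    (h : w ∈ abStar a b * (single c * KStar.kstar (single c))) : w ∉ abStar a b := by
  intro h'
  obtain ⟨u, -, v, hv, rfl⟩ := Language.mem_mul.1 h
  obtain ⟨v', -, rfl⟩ := mem_single_mul.1 hv
  rcases mem_abStar.1 h' c (by simp) with h | h
  · exact ha h.symm
  · exact hb h.symm

end

/-! ### A PRA-C for `(a,b)*cc*` -/

/-- Bounds that separate the acceptance probabilities of the words in `L` from those of the words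
outside `L` suffice for recognition. -/
lemma PRAC.isRecognizable_of_bounds {Q : Type} [Fintype Q] {α : Type*} (A : PRAC Q α)
    {L : Language α} {r s : ℝ} (hr : 0 ≤ r) (hrs : r < s) (hs : s ≤ 1)
    (h1 : ∀ w ∉ L, A.acceptProb w ≤ r) (h2 : ∀ w ∈ L, s ≤ A.acceptProb w) :
    IsRecognizable L := by
  have hU : r ∈ upperBounds (insert 0 {r : ℝ | ∃ w, w ∉ L ∧ r = A.acceptProb w}) := by
    rintro _ (rfl | ⟨w, hw, rfl⟩)
    exacts [hr, h1 w hw]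
  have hB : s ∈ lowerBounds (insert 1 {r : ℝ | ∃ w, w ∈ L ∧ r = A.acceptProb w}) := by
    rintro _ (rfl | ⟨w, hw, rfl⟩)
    exacts [hs, h2 w hw]
  have hlub := isLUB_csSup (Set.insert_nonempty _ _) ⟨r, hU⟩
  have hglb := isGLB_csInf (Set.insert_nonempty _ _) ⟨s, hB⟩
  exact ⟨Q, _, A, _, _, (hlub.2 hU).trans_lt (hrs.trans_le (hglb.2 hB)), hlub, hglb⟩

/-- The transition matrix that the automaton for `(a,b)*cc*` applies on reading a tape symbol: the
letter `c = 2` averages the states `0` and `1`, the letters `a = 0` and `b = 1` average the states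
`1` and `2`, and the end-markers do nothing. -/
noncomputable def abccMatrix : TapeSymbol (Fin 3) → Matrix (Fin 3) (Fin 3) ℝ
  | .letter x =>
    if x = 2 then !![1 / 2, 1 / 2, 0; 1 / 2, 1 / 2, 0; 0, 0, 1]
    else !![1, 0, 0; 0, 1 / 2, 1 / 2; 0, 1 / 2, 1 / 2]
  | _ => 1

lemma abccMatrix_mem_doublyStochastic (σ : TapeSymbol (Fin 3)) :
    abccMatrix σ ∈ doublyStochastic ℝ (Fin 3) := by
  rcases σ with _ | x | _
  · exact one_mem _
  · rw [abccMatrix, mem_doublyStochastic_iff_sum]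
    split_ifs <;> simp [Fin.forall_fin_succ, Fin.sum_univ_three] <;> norm_num
  · exact one_mem _

/-- The automaton with states `0`, `1`, `2` that starts in `0` and accepts in `1`. -/
noncomputable def abccAutomaton : PRAC (Fin 3) (Fin 3) where
  init := 0
  accepting := {1}
  δ q σ q' := abccMatrix σ q q'
  δ_nonneg _ σ _ := nonneg_of_mem_doublyStochastic (abccMatrix_mem_doublyStochastic σ)
  δ_le_one _ σ _ := le_one_of_mem_doublyStochastic (abccMatrix_mem_doublyStochastic σ)
  sum_target q σ := sum_row_of_mem_doublyStochastic (abccMatrix_mem_doublyStochastic σ) q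
  sum_source q' σ := sum_col_of_mem_doublyStochastic (abccMatrix_mem_doublyStochastic σ) q'

lemma abccAutomaton_step (p : Fin 3 → ℝ) (σ : TapeSymbol (Fin 3)) :
    abccAutomaton.step p σ = p ᵥ* abccMatrix σ := rfl

/-- The distribution of the automaton after it has read `w`, without the end-markers. -/
noncomputable def abccDist (w : List (Fin 3)) : Fin 3 → ℝ :=
  (w.map TapeSymbol.letter).foldl abccAutomaton.step ![1, 0, 0]

lemma abccDist_append_two (w : List (Fin 3)) : abccDist (w ++ [2]) =
    ![(abccDist w 0 + abccDist w 1) / 2, (abccDist w 0 + abccDist w 1) / 2, abccDist w 2] := by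
  rw [abccDist, List.map_append, List.foldl_append, ← abccDist, List.map_singleton,
    List.foldl_cons, List.foldl_nil, abccAutomaton_step, abccMatrix, if_pos rfl]
  ext i
  fin_cases i <;> simp [vecMul, dotProduct, Fin.sum_univ_three] <;> ring

lemma abccDist_append_of_ne_two (w : List (Fin 3)) {x : Fin 3} (hx : x ≠ 2) :
    abccDist (w ++ [x]) =
      ![abccDist w 0, (abccDist w 1 + abccDist w 2) / 2, (abccDist w 1 + abccDist w 2) / 2] := by
  rw [abccDist, List.map_append, List.foldl_append, ← abccDist, List.map_singleton,
    List.foldl_cons, List.foldl_nil, abccAutomaton_step, abccMatrix, if_neg hx]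
  ext i
  fin_cases i <;> simp [vecMul, dotProduct, Fin.sum_univ_three] <;> ring

lemma abccAutomaton_acceptProb (w : List (Fin 3)) :
    abccAutomaton.acceptProb w = abccDist w 1 := by
  have h0 : abccAutomaton.initDist = ![1, 0, 0] := by
    ext i
    fin_cases i <;> simp [PRAC.initDist, abccAutomaton]
  have h1 (p : Fin 3 → ℝ) : abccAutomaton.step p .leftEnd = p := vecMul_one p
  have h2 (p : Fin 3 → ℝ) : abccAutomaton.step p .rightEnd = p := vecMul_one p
  rw [PRAC.acceptProb, PRAC.finalDist, PRAC.tape, List.foldl_cons, h0, h1, List.foldl_append,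
    ← abccDist, List.foldl_cons, h2, List.foldl_nil]
  exact Finset.sum_singleton _ _

/-- The distribution is `(1, 0, 0)` on `(a,b)*` and `(1/2, 1/2, 0)` on `(a,b)*cc*`. On every other
word it is decreasing with last entry at least `1/4`, a condition that both averagings preserve and
that bounds the middle entry by `3/8`. -/
lemma abccDist_invariant (w : List (Fin 3)) :
    (w ∈ abStar (0 : Fin 3) 1 → abccDist w = ![1, 0, 0]) ∧
    (w ∈ abStar (0 : Fin 3) 1 * (single 2 * KStar.kstar (single 2)) →
      abccDist w = ![1 / 2, 1 / 2, 0]) ∧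
    (w ∉ abStar (0 : Fin 3) 1 → w ∉ abStar (0 : Fin 3) 1 * (single 2 * KStar.kstar (single 2)) →
      abccDist w 1 ≤ abccDist w 0 ∧ abccDist w 2 ≤ abccDist w 1 ∧ 1 / 4 ≤ abccDist w 2 ∧
      abccDist w 0 + abccDist w 1 + abccDist w 2 = 1) := by
  induction w using List.reverseRecOn with
  | nil =>
    have h : [] ∈ abStar (0 : Fin 3) 1 := mem_abStar.2 (by simp)
    refine ⟨fun _ => rfl, fun h' => ?_, fun h' => absurd h h'⟩
    exact absurd h (notMem_abStar_of_mem_abStar_mul (by decide) (by decide) h')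
  | append_singleton w x ih =>
    obtain ⟨ih0, ih1, ih2⟩ := ih
    rw [append_singleton_mem_abStar_mul]
    have hS : w ++ [x] ∈ abStar (0 : Fin 3) 1 ↔ w ∈ abStar (0 : Fin 3) 1 ∧ x ≠ 2 := by
      have : (x = 0 ∨ x = 1) ↔ x ≠ 2 := by revert x; decide
      simp only [mem_abStar, List.mem_append, List.mem_singleton, or_imp, forall_and,
        forall_eq, this]
    rw [hS]
    by_cases hx : x = 2
    · subst hx
      simp only [abccDist_append_two]
      refine ⟨fun h => absurd rfl h.2, fun h => ?_, fun _ h => ?_⟩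
      · rcases h.2 with h | h
        · simp [ih0 h]
        · simp [ih1 h]
      · push Not at h
        obtain ⟨h0, h1, h2, h3⟩ := ih2 (h trivial).1 (h trivial).2
        simp only [cons_val_zero, cons_val_one, cons_val]
        refine ⟨?_, ?_, ?_, ?_⟩ <;> linarith
    · simp only [abccDist_append_of_ne_two w hx]
      refine ⟨fun h => by simp [ih0 h.1], fun h => absurd h.1 hx, fun h _ => ?_⟩
      have hw : w ∉ abStar (0 : Fin 3) 1 := fun h' => h ⟨h', hx⟩
      simp only [cons_val_zero, cons_val_one, cons_val]
      by_cases hw' : w ∈ abStar (0 : Fin 3) 1 * (single 2 * KStar.kstar (single 2))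
      · rw [ih1 hw']
        refine ⟨?_, ?_, ?_, ?_⟩ <;> simp <;> norm_num
      · obtain ⟨h0, h1, h2, h3⟩ := ih2 hw hw'
        refine ⟨?_, ?_, ?_, ?_⟩ <;> linarith

lemma isRecognizable_abStar_mul_single_mul_kstar :
    IsRecognizable (abStar (0 : Fin 3) 1 * (single 2 * KStar.kstar (single 2))) := by
  refine abccAutomaton.isRecognizable_of_bounds (r := 3 / 8) (s := 1 / 2) (by norm_num)
    (by norm_num) (by norm_num) (fun w hw => ?_) fun w hw => ?_
  · rw [abccAutomaton_acceptProb]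
    by_cases hS : w ∈ abStar (0 : Fin 3) 1
    · rw [(abccDist_invariant w).1 hS]
      norm_num
    · obtain ⟨h0, h1, h2, h3⟩ := (abccDist_invariant w).2.2 hS hw
      linarith
  · rw [abccAutomaton_acceptProb, (abccDist_invariant w).2.1 hw]
    norm_num

/-! ### The homomorphic image -/

lemma homImage_abStar_mul_single_mul_kstar :
    homImage (![[0], [1], [0]] : Fin 3 → List (Fin 2))
        (abStar (0 : Fin 3) 1 * (single 2 * KStar.kstar (single 2))) =
      abStar (0 : Fin 2) 1 * single 0 := by
  ext v
  rw [mem_mul_single]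
  constructor
  · rintro ⟨w, hw, rfl⟩
    rcases List.eq_nil_or_concat' w with rfl | ⟨u, x, rfl⟩
    · exact absurd (mem_abStar.2 (by simp))
        (notMem_abStar_of_mem_abStar_mul (by decide) (by decide) hw)
    · obtain ⟨rfl, -⟩ := append_singleton_mem_abStar_mul.1 hw
      exact ⟨_, mem_abStar.2 fun y _ => by omega, by rw [List.flatMap_append]; rfl⟩
  · rintro ⟨u, -, rfl⟩
    refine ⟨u.map Fin.castSucc ++ [2], append_singleton_mem_abStar_mul.2 ⟨rfl, .inl ?_⟩, ?_⟩
    · refine mem_abStar.2 fun x hx => ?_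
      obtain ⟨y, -, rfl⟩ := List.mem_map.1 hx
      exact (by decide : ∀ y : Fin 2, y.castSucc = 0 ∨ y.castSucc = 1) y
    · have h : ∀ y : Fin 2, (![[0], [1], [0]] : Fin 3 → List (Fin 2)) y.castSucc = [y] := by decide
      rw [List.flatMap_append, List.flatMap_map]
      simp only [h, List.flatMap_singleton']
      rfl

end PRA

theorem mainTheorem6 :
    -- `(a,b)*a` and `a(a,b)*` are not recognized, over any finite alphabet containing `a ≠ b`
    (∀ (α : Type) [Finite α] (a b : α), a ≠ b →
      ¬ PRA.IsRecognizable (PRA.abStar a b * PRA.single a) ∧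
      ¬ PRA.IsRecognizable (PRA.single a * PRA.abStar a b)) ∧
    -- `(a,b)*cc*` over `{a, b, c}`, with `a = 0`, `b = 1`, `c = 2`, is recognized
    PRA.IsRecognizable
      (PRA.abStar (0 : Fin 3) 1 * (PRA.single 2 * KStar.kstar (PRA.single 2))) ∧
    -- its image under `a ↦ a`, `b ↦ b`, `c ↦ a` is `(a,b)*a` over `{a, b}`, with `a = 0`, `b = 1`
    PRA.homImage (![[0], [1], [0]] : Fin 3 → List (Fin 2))
        (PRA.abStar (0 : Fin 3) 1 * (PRA.single 2 * KStar.kstar (PRA.single 2))) =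
      PRA.abStar (0 : Fin 2) 1 * PRA.single 0 ∧
    ¬ PRA.ClosedUnderHomomorphisms := by
  have himage := PRA.homImage_abStar_mul_single_mul_kstar
  refine ⟨fun α _ a b hab => ⟨PRA.not_isRecognizable_abStar_mul_single hab,
    PRA.not_isRecognizable_single_mul_abStar hab⟩,
    PRA.isRecognizable_abStar_mul_single_mul_kstar, himage, fun hclosed => ?_⟩
  refine PRA.not_isRecognizable_abStar_mul_single (a := (0 : Fin 2)) (b := 1) (by decide) ?_
  rw [← himage]
  exact hclosed _ _ _ _ PRA.isRecognizable_abStar_mul_single_mul_kstar
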